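/- A signature consists of finitely many constant symbols (at least one) and finitely many predicate symbols; structures have non-empty domains, and homomorphisms preserve all relations and constants. A (disjunctive) tuple-generating dependency, (D)TGD, is an equality-free first-order sentence $\forall \mathbf{x}.\,\varphi(\mathbf{x}) \Rightarrow \exists \mathbf{y}.\,\psi(\mathbf{x},\mathbf{y})$, where $\varphi$ is a possibly empty conjunction of atoms and $\psi$ is a non-empty conjunction of atoms (for a TGD), respectively a non-empty disjunction of such conjunctions (for a disjunctive TGD); atoms may contain constants. $\mathbb{DTGD}$ is the class of finite conjunctions of disjunctive TGDs. $\mathbb{MDTGD}$ (mildly disjunctive TGD sentences) is the class of sentences $\Phi \vee \Psi$, where $\Phi$ is a finite conjunction of TGDs and $\Psi$ is a Boolean conjunctive query (an existentially quantified conjunction of atoms, equality atoms being allowed, or $\bot$). The problem $\mathrm{HomClosed}$ asks, given a signature $\tau$ and a $\tau$-sentence $\Phi$, whether the class of models of $\Phi$ equals its homomorphism closure, i.e. the class of all $\tau$-structures into which some model of $\Phi$ has a homomorphism. The problem $\mathrm{HomClosed}_{\mathrm{fin}}$ asks whether the class of finite models of $\Phi$ equals the class of all finite $\tau$-structures into which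 some finite model of $\Phi$ has a homomorphism. **Theorem.** $\mathrm{HomClosed}$ and $\mathrm{HomClosed}_{\mathrm{fin}}$ are both undecidable for $\mathbb{MDTGD}$ and for $\mathbb{DTGD}$. Both problems remain undecidable for the $\mathbb{DTGD}$ sentences, and for the $\mathbb{MDTGD}$ sentences, over signatures with predicates of arity at most $2$ in which every (disjunctive) TGD has at most $4$ universally and at most $1$ existentially quantified variable and, in the case of $\mathbb{MDTGD}$, the conjunctive query is not $\bot$, is equality-free and has at most $1$ variable. -/

import Mathlib

universe u

namespace HomClosure

open FirstOrder FirstOrder.Language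

/-- A finite relational signature with constants: constant symbols `0, …, numConst - 1`
(at least one) and predicate symbols `0, …, numPred - 1` with their arities. -/
structure Signature where
  numConst : ℕ
  numConst_pos : 0 < numConst
  numPred : ℕ
  arity : Fin numPred → ℕ

/-- The first-order language of a signature; constants are function symbols of arity `0`, and
there are no other function symbols. -/
def Signature.language (τ : Signature) : FirstOrder.Language.{0, 0} where
  Functions := fun
    | 0 => Fin τ.numConst
    | _ + 1 => Empty
  Relations := fun k => {p : Fin τ.numPred // τ.arity p = k}

/-! ### Syntax -/

/-- A term is a variable from `V` or a constant symbol. -/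
inductive Tm (τ : Signature) (V : Type) : Type
  | var (x : V) : Tm τ V
  | const (c : Fin τ.numConst) : Tm τ V

/-- A relational (equality-free) atom `P(t₁, …, tₖ)` with variables from `V`. -/
structure Atom (τ : Signature) (V : Type) where
  pred : Fin τ.numPred
  args : Fin (τ.arity pred) → Tm τ V

/-- An atom that may be an equality. -/
inductive EqAtom (τ : Signature) (V : Type) : Type
  | rel (a : Atom τ V) : EqAtom τ V
  | eq (s t : Tm τ V) : EqAtom τ V

/-- A tuple-generating dependency `∀ x. φ(x) ⇒ ∃ y. ψ(x, y)`. Its universally quantified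
variables are indexed by `Fin numAll`, its existentially quantified ones by `Fin numEx`; `body` is
a (possibly empty) conjunction of atoms and `head` a non-empty one. -/
structure TGD (τ : Signature) where
  numAll : ℕ
  numEx : ℕ
  body : List (Atom τ (Fin numAll))
  head : List (Atom τ (Fin numAll ⊕ Fin numEx))
  head_ne : head ≠ []

/-- A disjunctive tuple-generating dependency `∀ x. φ(x) ⇒ ∃ y. ψ(x, y)`; here `head` is a
non-empty disjunction of (non-empty) conjunctions of atoms. -/
structure DisjTGD (τ : Signature) where
  numAll : ℕ
  numEx : ℕ
  body : List (Atom τ (Fin numAll))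
  head : List (List (Atom τ (Fin numAll ⊕ Fin numEx)))
  head_ne : head ≠ []
  head_conj_ne : ∀ ψ ∈ head, ψ ≠ []

/-- A Boolean conjunctive query: the sentence `⊥`, or `∃ x. ψ(x)` with `ψ` a conjunction of atoms,
equality being allowed. -/
inductive CQ (τ : Signature) : Type
  | falsum : CQ τ
  | ex (numEx : ℕ) (conj : List (EqAtom τ (Fin numEx))) : CQ τ

/-- A DTGD sentence: a finite conjunction of disjunctive TGDs. -/
structure DTGD (τ : Signature) where
  rules : List (DisjTGD τ)

/-- A mildly disjunctive TGD sentence `Φ ∨ Ψ`: `Φ` is a finite conjunction of TGDs, `Ψ` is a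
conjunctive query. -/
structure MDTGD (τ : Signature) where
  rules : List (TGD τ)
  query : CQ τ

/-! ### The first-order sentences denoted by the syntax -/

section Sentences

variable {τ : Signature} {V : Type}

def Tm.toTerm : Tm τ V → τ.language.Term V
  | .var x => Term.var x
  | .const c => Constants.term (L := τ.language) c

def Atom.toFormula (a : Atom τ V) : τ.language.Formula V :=
  Relations.formula (L := τ.language) (n := τ.arity a.pred) ⟨a.pred, rfl⟩
    fun i => (a.args i).toTerm

def EqAtom.toFormula : EqAtom τ V → τ.language.Formula V
  | .rel a => a.toFormula
  | .eq s t => Term.equal s.toTerm t.toTerm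

/-- Finite conjunction. -/
def conj {L : FirstOrder.Language.{0, 0}} (l : List (L.Formula V)) : L.Formula V :=
  l.foldr (· ⊓ ·) ⊤

/-- Finite disjunction. -/
def disj {L : FirstOrder.Language.{0, 0}} (l : List (L.Formula V)) : L.Formula V :=
  l.foldr (· ⊔ ·) ⊥

/-- The sentence `∀ x₁ … xₘ. φ`. -/
noncomputable def univClosure {L : FirstOrder.Language.{0, 0}} {m : ℕ} (φ : L.Formula (Fin m)) :
    L.Sentence :=
  (φ.relabel Sum.inr : L.Formula (Empty ⊕ Fin m)).iAlls (Fin m)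

/-- The sentence `∃ x₁ … xₘ. φ`. -/
noncomputable def exClosure {L : FirstOrder.Language.{0, 0}} {m : ℕ} (φ : L.Formula (Fin m)) :
    L.Sentence :=
  (φ.relabel Sum.inr : L.Formula (Empty ⊕ Fin m)).iExs (Fin m)

noncomputable def TGD.toSentence (r : TGD τ) : τ.language.Sentence :=
  univClosure ((conj (r.body.map Atom.toFormula)).imp
    ((conj (r.head.map Atom.toFormula)).iExs (Fin r.numEx)))

noncomputable def DisjTGD.toSentence (r : DisjTGD τ) : τ.language.Sentence :=
  univClosure ((conj (r.body.map Atom.toFormula)).imp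
    ((disj (r.head.map fun ψ => conj (ψ.map Atom.toFormula))).iExs (Fin r.numEx)))

noncomputable def CQ.toSentence : CQ τ → τ.language.Sentence
  | .falsum => ⊥
  | .ex _ ψ => exClosure (conj (ψ.map EqAtom.toFormula))

noncomputable def DTGD.toSentence (Φ : DTGD τ) : τ.language.Sentence :=
  conj (Φ.rules.map DisjTGD.toSentence)

noncomputable def MDTGD.toSentence (Φ : MDTGD τ) : τ.language.Sentence :=
  conj (Φ.rules.map TGD.toSentence) ⊔ Φ.query.toSentence

end Sentences

/-! ### Structures, homomorphism closures, homclosedness -/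

/-- A structure of signature `τ`: its domain is non-empty and may be finite or infinite. -/
structure Struct (τ : Signature) : Type (u + 1) where
  Dom : Type u
  [inst : τ.language.Structure Dom]
  [nonempty : Nonempty Dom]

attribute [instance] Struct.inst Struct.nonempty

variable {τ : Signature}

/-- The class of all models of `Φ`. -/
def models (Φ : τ.language.Sentence) : Set (Struct.{u} τ) := {A | A.Dom ⊨ Φ}

/-- The class of all finite models of `Φ`. -/
def finModels (Φ : τ.language.Sentence) : Set (Struct.{u} τ) := {A | A.Dom ⊨ Φ ∧ Finite A.Dom}

/-- The class of all structures into which some structure from `C` has a homomorphism. -/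
def homClosure (C : Set (Struct.{u} τ)) : Set (Struct.{u} τ) :=
  {B | ∃ A ∈ C, Nonempty (A.Dom →[τ.language] B.Dom)}

/-- The class of all finite structures into which some structure from `C` has a homomorphism. -/
def homClosureFin (C : Set (Struct.{u} τ)) : Set (Struct.{u} τ) :=
  {B ∈ homClosure C | Finite B.Dom}

/-- The models of `Φ` are closed under homomorphisms. -/
def HomClosed (Φ : τ.language.Sentence) : Prop :=
  models.{u} Φ = homClosure (models.{u} Φ)

/-- The finite models of `Φ` are closed under homomorphisms with finite target. -/
def HomClosedFin (Φ : τ.language.Sentence) : Prop :=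
  finModels.{u} Φ = homClosureFin (finModels.{u} Φ)

/-! ### Presentation of inputs as finite data -/

section Codes

variable {V : Type}

/-- A variable is presented by its number, tagged `inl`, a constant by its number, tagged `inr`. -/
abbrev TmCode := ℕ ⊕ ℕ
/-- Predicate number and list of arguments. -/
abbrev AtomCode := ℕ × List TmCode
abbrev EqAtomCode := AtomCode ⊕ (TmCode × TmCode)
/-- Number of universal variables, number of existential variables, body, head. -/
abbrev TGDCode := ℕ × ℕ × List AtomCode × List AtomCode
/-- Number of universal variables, number of existential variables, body, list of disjuncts. -/
abbrev DisjTGDCode := ℕ × ℕ × List AtomCode × List (List AtomCode)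
abbrev CQCode := Option (ℕ × List EqAtomCode)
/-- Number of constants and list of arities. -/
abbrev SigCode := ℕ × List ℕ

def Signature.code (τ : Signature) : SigCode := (τ.numConst, List.ofFn τ.arity)

def Tm.code (e : V → ℕ) : Tm τ V → TmCode
  | .var x => .inl (e x)
  | .const c => .inr c

def Atom.code (e : V → ℕ) (a : Atom τ V) : AtomCode :=
  (a.pred, List.ofFn fun i => (a.args i).code e)

def EqAtom.code (e : V → ℕ) : EqAtom τ V → EqAtomCode
  | .rel a => .inl (a.code e)
  | .eq s t => .inr (s.code e, t.code e)

/-- The numbering of the variables of a rule: first the universal, then the existential ones. -/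
def varNum {m n : ℕ} : Fin m ⊕ Fin n → ℕ
  | .inl i => i
  | .inr j => m + j

def TGD.code (r : TGD τ) : TGDCode :=
  (r.numAll, r.numEx, r.body.map (Atom.code Fin.val), r.head.map (Atom.code varNum))

def DisjTGD.code (r : DisjTGD τ) : DisjTGDCode :=
  (r.numAll, r.numEx, r.body.map (Atom.code Fin.val),
    r.head.map fun ψ => ψ.map (Atom.code varNum))

def CQ.code : CQ τ → CQCode
  | .falsum => none
  | .ex n ψ => some (n, ψ.map (EqAtom.code Fin.val))

/-- The input consisting of a signature and a DTGD sentence over it, as finite data. -/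
def DTGD.code (Φ : DTGD τ) : SigCode × List DisjTGDCode :=
  (τ.code, Φ.rules.map DisjTGD.code)

/-- The input consisting of a signature and an MDTGD sentence over it, as finite data. -/
def MDTGD.code (Φ : MDTGD τ) : SigCode × List TGDCode × CQCode :=
  (τ.code, Φ.rules.map TGD.code, Φ.query.code)

end Codes

/-! ### Undecidability -/

/-- The problem `P`, on the inputs that satisfy `D` and are presented through `code`, is
undecidable: no total computable function answers it correctly on all of these inputs (whatever it
does elsewhere). -/
def Undecidable {I C : Type*} [Primcodable C] (code : I → C) (D P : I → Prop) : Prop :=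
  ¬ ∃ f : C → Bool, Computable f ∧ ∀ i, D i → (f (code i) = true ↔ P i)

/-- `P` is undecidable for the MDTGD sentences (over arbitrary signatures) that satisfy `D`. -/
def UndecidableForMDTGD (D : ∀ τ : Signature, MDTGD τ → Prop)
    (P : ∀ τ : Signature, τ.language.Sentence → Prop) : Prop :=
  Undecidable (I := Σ τ : Signature, MDTGD τ) (fun i => i.2.code) (fun i => D i.1 i.2)
    (fun i => P i.1 i.2.toSentence)

/-- `P` is undecidable for the DTGD sentences (over arbitrary signatures) that satisfy `D`. -/
def UndecidableForDTGD (D : ∀ τ : Signature, DTGD τ → Prop)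
    (P : ∀ τ : Signature, τ.language.Sentence → Prop) : Prop :=
  Undecidable (I := Σ τ : Signature, DTGD τ) (fun i => i.2.code) (fun i => D i.1 i.2)
    (fun i => P i.1 i.2.toSentence)

/-! ### The syntactic restrictions -/

/-- The query has at most `n` variables, and it is not `⊥` and does not use equality. -/
def CQ.Small (n : ℕ) : CQ τ → Prop
  | .falsum => False
  | .ex k ψ => k ≤ n ∧ ∀ a ∈ ψ, ∃ b : Atom τ (Fin k), a = .rel b

/-- All predicates of the signature have arity at most `k`, every disjunctive TGD has at most `m`
universally and at most `n` existentially quantified variables. -/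
def DTGD.Small (m n k : ℕ) (Φ : DTGD τ) : Prop :=
  (∀ p, τ.arity p ≤ k) ∧ ∀ r ∈ Φ.rules, r.numAll ≤ m ∧ r.numEx ≤ n

/-- All predicates of the signature have arity at most `k`, every TGD has at most `m` universally
and at most `n` existentially quantified variables, the query has at most `n` variables and is
equality-free. -/
def MDTGD.Small (m n k : ℕ) (Φ : MDTGD τ) : Prop :=
  (∀ p, τ.arity p ≤ k) ∧ (∀ r ∈ Φ.rules, r.numAll ≤ m ∧ r.numEx ≤ n) ∧ Φ.query.Small n

end HomClosure

namespace HomClosure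

/-! ### Programs over a finite set of states and their big-step semantics -/

/-- The instruction attached to a state of a program; states play the role of procedures that
transform lists of natural numbers. -/
inductive Instr (σ : Type) : Type
  | zero : Instr σ
  | succ : Instr σ
  | tail : Instr σ
  | cons (f g : σ) : Instr σ
  | comp (f g : σ) : Instr σ
  | case (f g : σ) : Instr σ
  | fix (f : σ) : Instr σ

/-- `Evaluates P q v w`: procedure `q` of the program `P` returns `w` on input `v`. -/
inductive Evaluates {σ : Type} (P : σ → Instr σ) : σ → List ℕ → List ℕ → Prop
  | zero {q v} (hq : P q = .zero) : Evaluates P q v (0 :: v)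
  | succ {q v} (hq : P q = .succ) : Evaluates P q v [v.headI + 1]
  | tail {q v} (hq : P q = .tail) : Evaluates P q v v.tail
  | cons {q f g v a b} (hq : P q = .cons f g) (hf : Evaluates P f v a) (hg : Evaluates P g v b) :
      Evaluates P q v (a.headI :: b)
  | comp {q f g v a b} (hq : P q = .comp f g) (hg : Evaluates P g v a) (hf : Evaluates P f a b) :
      Evaluates P q v b
  | case_zero {q f g v a} (hq : P q = .case f g) (hv : v.headI = 0)
      (hf : Evaluates P f v.tail a) : Evaluates P q v a
  | case_succ {q f g v n a} (hq : P q = .case f g) (hv : v.headI = n + 1)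
      (hg : Evaluates P g (n :: v.tail) a) : Evaluates P q v a
  | fix_done {q f v a} (hq : P q = .fix f) (hf : Evaluates P f v a) (ha : a.headI = 0) :
      Evaluates P q v a.tail
  | fix_step {q f v a b} (hq : P q = .fix f) (hf : Evaluates P f v a) (ha : a.headI ≠ 0)
      (hr : Evaluates P q a.tail b) : Evaluates P q v b

theorem Evaluates.unique {σ : Type} {P : σ → Instr σ} {q : σ} {v w w' : List ℕ}
    (h : Evaluates P q v w) (h' : Evaluates P q v w') : w = w' := by
  induction h generalizing w' with
  | zero hq | succ hq | tail hq => cases h' <;> simp_all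
  | cons hq _ _ ihf ihg =>
    cases h' with
    | cons hq' hf hg =>
      cases hq.symm.trans hq'
      rw [ihf hf, ihg hg]
    | _ => simp_all
  | comp hq _ _ ihg ihf =>
    cases h' with
    | comp hq' hg hf =>
      cases hq.symm.trans hq'
      obtain rfl := ihg hg
      exact ihf hf
    | _ => simp_all
  | case_zero hq hv _ ih =>
    cases h' with
    | case_zero hq' hv' hf =>
      cases hq.symm.trans hq'
      exact ih hf
    | _ => simp_all
  | case_succ hq hv _ ih =>
    cases h' with
    | case_succ hq' hv' hg =>
      cases hq.symm.trans hq'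
      cases hv.symm.trans hv'
      exact ih hg
    | _ => simp_all
  | fix_done hq _ ha ih =>
    cases h' with
    | fix_done hq' hf ha' =>
      cases hq.symm.trans hq'
      rw [ih hf]
    | fix_step hq' hf ha' hr =>
      cases hq.symm.trans hq'
      exact absurd (ih hf ▸ ha) ha'
    | _ => simp_all
  | fix_step hq _ ha _ ihf ihr =>
    cases h' with
    | fix_done hq' hf ha' =>
      cases hq.symm.trans hq'
      exact absurd (ihf hf ▸ ha') ha
    | fix_step hq' hf ha' hr =>
      cases hq.symm.trans hq'
      obtain rfl := ihf hf
      exact ihr hr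
    | _ => simp_all

/-! ### Compilation of `Turing.ToPartrec.Code` -/

open Turing.ToPartrec

/-- The codes occurring in a code, including itself. -/
def subcodes : Code → Set Code
  | .zero' => {.zero'}
  | .succ => {.succ}
  | .tail => {.tail}
  | .cons f g => insert (.cons f g) (subcodes f ∪ subcodes g)
  | .comp f g => insert (.comp f g) (subcodes f ∪ subcodes g)
  | .case f g => insert (.case f g) (subcodes f ∪ subcodes g)
  | .fix f => insert (.fix f) (subcodes f)

theorem self_mem_subcodes (c : Code) : c ∈ subcodes c := by
  cases c <;> simp [subcodes]

theorem finite_subcodes (c : Code) : (subcodes c).Finite := by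
  induction c <;> simp_all [subcodes]

theorem subcodes_subset {c d : Code} (h : d ∈ subcodes c) : subcodes d ⊆ subcodes c := by
  induction c with
  | zero' => rw [show d = .zero' from h]
  | succ => rw [show d = .succ from h]
  | tail => rw [show d = .tail from h]
  | cons f g ihf ihg | comp f g ihf ihg | case f g ihf ihg =>
    rcases h with rfl | h | h
    · rfl
    · exact (ihf h).trans fun x hx => .inr (.inl hx)
    · exact (ihg h).trans fun x hx => .inr (.inr hx)
  | fix f ihf =>
    rcases h with rfl | h
    · rfl
    · exact (ihf h).trans fun x hx => .inr hx

/-- The program whose procedures are the subcodes of `c`. -/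
def program (c : Code) : subcodes c → Instr (subcodes c)
  | ⟨.zero', _⟩ => .zero
  | ⟨.succ, _⟩ => .succ
  | ⟨.tail, _⟩ => .tail
  | ⟨.cons f g, h⟩ => .cons ⟨f, subcodes_subset h (.inr (.inl (self_mem_subcodes f)))⟩
      ⟨g, subcodes_subset h (.inr (.inr (self_mem_subcodes g)))⟩
  | ⟨.comp f g, h⟩ => .comp ⟨f, subcodes_subset h (.inr (.inl (self_mem_subcodes f)))⟩
      ⟨g, subcodes_subset h (.inr (.inr (self_mem_subcodes g)))⟩
  | ⟨.case f g, h⟩ => .case ⟨f, subcodes_subset h (.inr (.inl (self_mem_subcodes f)))⟩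
      ⟨g, subcodes_subset h (.inr (.inr (self_mem_subcodes g)))⟩
  | ⟨.fix f, h⟩ => .fix ⟨f, subcodes_subset h (.inr (self_mem_subcodes f))⟩

theorem evaluates_program (c d : Code) (hd : d ∈ subcodes c) {v w : List ℕ} (h : w ∈ d.eval v) :
    Evaluates (program c) ⟨d, hd⟩ v w := by
  induction d generalizing v w with
  | zero' =>
    obtain rfl : w = 0 :: v := by simpa [pure, PFun.pure] using h
    exact .zero rfl
  | succ =>
    obtain rfl : w = [v.headI + 1] := by simpa [pure, PFun.pure] using h
    exact .succ rfl
  | tail =>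
    obtain rfl : w = v.tail := by simpa [pure, PFun.pure] using h
    exact .tail rfl
  | cons f g ihf ihg =>
    simp only [Code.cons_eval, Part.bind_eq_bind, Part.mem_bind_iff, Part.pure_eq_some,
      Part.mem_some_iff] at h
    obtain ⟨a, ha, b, hb, rfl⟩ := h
    exact .cons rfl (ihf _ ha) (ihg _ hb)
  | comp f g ihf ihg =>
    rw [Code.comp_eval] at h
    obtain ⟨a, ha, hb⟩ := Part.mem_bind_iff.1 h
    exact .comp rfl (ihg _ ha) (ihf _ hb)
  | case f g ihf ihg =>
    simp only [Code.case_eval] at h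
    rcases hv : v.headI with _ | n <;> rw [hv] at h
    · exact .case_zero rfl hv (ihf _ h)
    · exact .case_succ rfl hv (ihg _ h)
  | fix f ihf =>
    rw [Code.fix_eval] at h
    refine PFun.fixInduction' (C := fun v => Evaluates (program c) ⟨f.fix, hd⟩ v w) h ?_ ?_
    · intro a ha
      obtain ⟨b, hb, he⟩ := (Part.mem_map_iff _).1 ha
      split_ifs at he with h0
      obtain rfl := Sum.inl.inj he
      exact .fix_done rfl (ihf _ hb) h0
    · intro a a' _ ha ih
      obtain ⟨b, hb, he⟩ := (Part.mem_map_iff _).1 ha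
      split_ifs at he with h0
      obtain rfl := Sum.inr.inj he
      exact .fix_step rfl (ihf _ hb) h0 ih

/-- A program whose inputs with output `0` cannot be computably separated from those with
output `1`. -/
theorem exists_inseparable_program : ∃ (σ : Type) (_ : Finite σ) (P : σ → Instr σ) (q₀ : σ),
    ∀ f : ℕ → Bool, Computable f → ∃ n,
      (f n = true ∧ Evaluates P q₀ [n] [1]) ∨ (f n = false ∧ Evaluates P q₀ [n] [0]) := by
  let U : ℕ →. ℕ := fun n => (Denumerable.ofNat Nat.Partrec.Code n).eval n
  have hU : Partrec U := Nat.Partrec.Code.eval_part.comp (Computable.ofNat _) Computable.id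
  obtain ⟨c, hc⟩ := Code.exists_code (Nat.Partrec'.part_iff₁.2 hU)
  refine ⟨subcodes c, (finite_subcodes c).to_subtype, program c, ⟨c, self_mem_subcodes c⟩, ?_⟩
  intro f hf
  have hg : Computable fun n => cond (f n) 1 0 :=
    Computable.cond hf (Computable.const 1) (Computable.const 0)
  obtain ⟨d, hd⟩ := Nat.Partrec.Code.exists_code.1 (Partrec.nat_iff.1 hg.partrec)
  let n := Encodable.encode d
  have hn : [cond (f n) 1 0] ∈ c.eval [n] := by
    have h := hc (n ::ᵥ List.Vector.nil)
    have hUn : U n = Part.some (cond (f n) 1 0) := by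
      simp only [U, n, Denumerable.ofNat_encode, hd]
      rfl
    simp only [List.Vector.head_cons, hUn] at h
    simp only [List.Vector.cons] at h
    rw [h]
    simp [pure]
  refine ⟨n, ?_⟩
  cases hfn : f n <;> rw [hfn] at hn
  · exact .inr ⟨rfl, evaluates_program _ _ _ hn⟩
  · exact .inl ⟨rfl, evaluates_program _ _ _ hn⟩

/-- A set of calls is closed if it contains all calls made by its members. -/
structure CallClosed {σ : Type} (P : σ → Instr σ) (S : Set (σ × List ℕ)) : Prop where
  cons_left : ∀ {q f g v}, P q = .cons f g → (q, v) ∈ S → (f, v) ∈ S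
  cons_right : ∀ {q f g v}, P q = .cons f g → (q, v) ∈ S → (g, v) ∈ S
  comp_inner : ∀ {q f g v}, P q = .comp f g → (q, v) ∈ S → (g, v) ∈ S
  comp_outer : ∀ {q f g v w}, P q = .comp f g → (q, v) ∈ S → Evaluates P g v w → (f, w) ∈ S
  case_zero : ∀ {q f g v}, P q = .case f g → (q, v) ∈ S → v.headI = 0 → (f, v.tail) ∈ S
  case_succ : ∀ {q f g v n}, P q = .case f g → (q, v) ∈ S → v.headI = n + 1 →
    (g, n :: v.tail) ∈ S
  fix_body : ∀ {q f v}, P q = .fix f → (q, v) ∈ S → (f, v) ∈ S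
  fix_step : ∀ {q f v w}, P q = .fix f → (q, v) ∈ S → Evaluates P f v w → w.headI ≠ 0 →
    (q, w.tail) ∈ S

theorem CallClosed.union {σ : Type} {P : σ → Instr σ} {S T : Set (σ × List ℕ)}
    (hS : CallClosed P S) (hT : CallClosed P T) : CallClosed P (S ∪ T) where
  cons_left := by
    rintro q f g v hq (h | h); exacts [.inl (hS.cons_left hq h), .inr (hT.cons_left hq h)]
  cons_right := by
    rintro q f g v hq (h | h); exacts [.inl (hS.cons_right hq h), .inr (hT.cons_right hq h)]
  comp_inner := by
    rintro q f g v hq (h | h); exacts [.inl (hS.comp_inner hq h), .inr (hT.comp_inner hq h)]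
  comp_outer := by
    rintro q f g v w hq (h | h) hw
    exacts [.inl (hS.comp_outer hq h hw), .inr (hT.comp_outer hq h hw)]
  case_zero := by
    rintro q f g v hq (h | h) hv
    exacts [.inl (hS.case_zero hq h hv), .inr (hT.case_zero hq h hv)]
  case_succ := by
    rintro q f g v n hq (h | h) hv
    exacts [.inl (hS.case_succ hq h hv), .inr (hT.case_succ hq h hv)]
  fix_body := by
    rintro q f v hq (h | h); exacts [.inl (hS.fix_body hq h), .inr (hT.fix_body hq h)]
  fix_step := by
    rintro q f v w hq (h | h) hw h0
    exacts [.inl (hS.fix_step hq h hw h0), .inr (hT.fix_step hq h hw h0)]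

theorem CallClosed.empty {σ : Type} {P : σ → Instr σ} : CallClosed P ∅ := by
  constructor <;> simp

/-- A terminating evaluation makes only finitely many calls. -/
theorem Evaluates.exists_callClosed {σ : Type} {P : σ → Instr σ} {q : σ} {v w : List ℕ}
    (h : Evaluates P q v w) : ∃ S : Set (σ × List ℕ), S.Finite ∧ CallClosed P S ∧ (q, v) ∈ S := by
  -- It suffices to close the set of calls made directly.
  have main : ∀ {q v}, ∀ T : Set (σ × List ℕ), T.Finite → CallClosed P T →
      (∀ f g, P q = .cons f g → (f, v) ∈ T ∧ (g, v) ∈ T) →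
      (∀ f g, P q = .comp f g → (g, v) ∈ T ∧ ∀ a, Evaluates P g v a → (f, a) ∈ T) →
      (∀ f g, P q = .case f g → (v.headI = 0 → (f, v.tail) ∈ T) ∧
        ∀ n, v.headI = n + 1 → (g, n :: v.tail) ∈ T) →
      (∀ f, P q = .fix f → (f, v) ∈ T ∧
        ∀ a, Evaluates P f v a → a.headI ≠ 0 → (q, a.tail) ∈ T) →
      ∃ S : Set (σ × List ℕ), S.Finite ∧ CallClosed P S ∧ (q, v) ∈ S := by
    intro q v T hT hc h1 h2 h3 h4
    refine ⟨insert (q, v) T, hT.insert _, ?_, .inl rfl⟩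
    constructor
    · rintro q' f g v' hq (e | e)
      · cases e; exact .inr (h1 _ _ hq).1
      · exact .inr (hc.cons_left hq e)
    · rintro q' f g v' hq (e | e)
      · cases e; exact .inr (h1 _ _ hq).2
      · exact .inr (hc.cons_right hq e)
    · rintro q' f g v' hq (e | e)
      · cases e; exact .inr (h2 _ _ hq).1
      · exact .inr (hc.comp_inner hq e)
    · rintro q' f g v' a hq (e | e) ha
      · cases e; exact .inr ((h2 _ _ hq).2 _ ha)
      · exact .inr (hc.comp_outer hq e ha)
    · rintro q' f g v' hq (e | e) hv
      · cases e; exact .inr ((h3 _ _ hq).1 hv)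
      · exact .inr (hc.case_zero hq e hv)
    · rintro q' f g v' n hq (e | e) hv
      · cases e; exact .inr ((h3 _ _ hq).2 _ hv)
      · exact .inr (hc.case_succ hq e hv)
    · rintro q' f v' hq (e | e)
      · cases e; exact .inr (h4 _ hq).1
      · exact .inr (hc.fix_body hq e)
    · rintro q' f v' a hq (e | e) ha h0
      · cases e; exact .inr ((h4 _ hq).2 _ ha h0)
      · exact .inr (hc.fix_step hq e ha h0)
  induction h with
  | zero hq =>
    exact main ∅ Set.finite_empty .empty (by simp [hq]) (by simp [hq])
      (by simp [hq]) (by simp [hq])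
  | succ hq =>
    exact main ∅ Set.finite_empty .empty (by simp [hq]) (by simp [hq])
      (by simp [hq]) (by simp [hq])
  | tail hq =>
    exact main ∅ Set.finite_empty .empty (by simp [hq]) (by simp [hq])
      (by simp [hq]) (by simp [hq])
  | cons hq hf hg ihf ihg =>
    obtain ⟨S, hS, hSc, hSm⟩ := ihf
    obtain ⟨T, hT, hTc, hTm⟩ := ihg
    refine main (S ∪ T) (hS.union hT) (hSc.union hTc) ?_ (by simp [hq])
      (by simp [hq]) (by simp [hq])
    rintro f' g' e
    rw [hq] at e
    cases e
    exact ⟨.inl hSm, .inr hTm⟩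
  | comp hq hg hf ihg ihf =>
    obtain ⟨S, hS, hSc, hSm⟩ := ihg
    obtain ⟨T, hT, hTc, hTm⟩ := ihf
    refine main (S ∪ T) (hS.union hT) (hSc.union hTc) (by simp [hq]) ?_
      (by simp [hq]) (by simp [hq])
    rintro f' g' e
    rw [hq] at e
    cases e
    exact ⟨.inl hSm, fun a ha => .inr (hg.unique ha ▸ hTm)⟩
  | case_zero hq hv hf ih =>
    obtain ⟨S, hS, hSc, hSm⟩ := ih
    refine main S hS hSc (by simp [hq]) (by simp [hq]) ?_ (by simp [hq])
    rintro f' g' e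
    rw [hq] at e
    cases e
    exact ⟨fun _ => hSm, fun n hn => by omega⟩
  | case_succ hq hv hf ih =>
    obtain ⟨S, hS, hSc, hSm⟩ := ih
    refine main S hS hSc (by simp [hq]) (by simp [hq]) ?_ (by simp [hq])
    rintro f' g' e
    rw [hq] at e
    cases e
    refine ⟨fun _ => by omega, fun n hn => ?_⟩
    rw [hv] at hn
    cases hn
    exact hSm
  | fix_done hq hf ha ih =>
    obtain ⟨S, hS, hSc, hSm⟩ := ih
    refine main S hS hSc (by simp [hq]) (by simp [hq]) (by simp [hq]) ?_
    rintro f' e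
    rw [hq] at e
    cases e
    exact ⟨hSm, fun a' ha' h0 => absurd (hf.unique ha' ▸ ha) h0⟩
  | fix_step hq hf ha hr ihf ihr =>
    obtain ⟨S, hS, hSc, hSm⟩ := ihf
    obtain ⟨T, hT, hTc, hTm⟩ := ihr
    refine main (S ∪ T) (hS.union hT) (hSc.union hTc) (by simp [hq])
      (by simp [hq]) (by simp [hq]) ?_
    rintro f' e
    rw [hq] at e
    cases e
    exact ⟨.inl hSm, fun a' ha' _ => .inr (hf.unique ha' ▸ hTm)⟩

open FirstOrder FirstOrder.Language

/-! ### Semantics of the sentences -/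

section Realize

variable {τ : Signature} {V : Type} {A : Type u} [τ.language.Structure A]

theorem realize_conj {L : FirstOrder.Language.{0, 0}} {A : Type u} [L.Structure A]
    (l : List (L.Formula V)) (v : V → A) : (conj l).Realize v ↔ ∀ φ ∈ l, φ.Realize v :=
  BoundedFormula.realize_foldr_inf l v default

theorem realize_disj {L : FirstOrder.Language.{0, 0}} {A : Type u} [L.Structure A]
    (l : List (L.Formula V)) (v : V → A) : (disj l).Realize v ↔ ∃ φ ∈ l, φ.Realize v :=
  BoundedFormula.realize_foldr_sup l v default

theorem realize_univClosure {L : FirstOrder.Language.{0, 0}} {A : Type u} [L.Structure A] {m : ℕ}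
    (φ : L.Formula (Fin m)) : A ⊨ univClosure φ ↔ ∀ v : Fin m → A, φ.Realize v := by
  simp only [univClosure, Sentence.Realize, Formula.realize_iAlls, Formula.realize_relabel]
  rfl

theorem realize_exClosure {L : FirstOrder.Language.{0, 0}} {A : Type u} [L.Structure A] {m : ℕ}
    (φ : L.Formula (Fin m)) : A ⊨ exClosure φ ↔ ∃ v : Fin m → A, φ.Realize v := by
  simp only [exClosure, Sentence.Realize, Formula.realize_iExs, Formula.realize_relabel]
  rfl

theorem TGD.realize_toSentence (r : TGD τ) : A ⊨ r.toSentence ↔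
    ∀ v : Fin r.numAll → A, (∀ a ∈ r.body, a.toFormula.Realize v) →
      ∃ y : Fin r.numEx → A, ∀ a ∈ r.head, a.toFormula.Realize (Sum.elim v y) := by
  simp [TGD.toSentence, realize_univClosure, realize_conj]

theorem DisjTGD.realize_toSentence (r : DisjTGD τ) : A ⊨ r.toSentence ↔
    ∀ v : Fin r.numAll → A, (∀ a ∈ r.body, a.toFormula.Realize v) →
      ∃ y : Fin r.numEx → A, ∃ ψ ∈ r.head, ∀ a ∈ ψ, a.toFormula.Realize (Sum.elim v y) := by
  simp [DisjTGD.toSentence, realize_univClosure, realize_conj, realize_disj]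

theorem DTGD.realize_toSentence (Φ : DTGD τ) :
    A ⊨ Φ.toSentence ↔ ∀ r ∈ Φ.rules, A ⊨ r.toSentence := by
  simp only [DTGD.toSentence, Sentence.Realize, realize_conj, List.forall_mem_map]

theorem MDTGD.realize_toSentence (Φ : MDTGD τ) :
    A ⊨ Φ.toSentence ↔ (∀ r ∈ Φ.rules, A ⊨ r.toSentence) ∨ A ⊨ Φ.query.toSentence := by
  simp only [MDTGD.toSentence, Sentence.Realize, Formula.realize_sup, realize_conj,
    List.forall_mem_map]

end Realize

/-! ### Binary signatures -/

/-- The signature with `n + 3` constants and `K` binary predicates. -/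
abbrev binSig (K n : ℕ) : Signature := ⟨n + 3, by omega, K, fun _ => 2⟩

section Binary

variable {K n : ℕ} {V : Type}

/-- The atom `p(s, t)`. -/
def binAtom (p : Fin K) (s t : Tm (binSig K n) V) : Atom (binSig K n) V := ⟨p, ![s, t]⟩

variable (A B : Struct.{u} (binSig K n))

/-- The value of a constant. -/
def constVal (c : Fin (n + 3)) : A.Dom :=
  Structure.funMap (L := (binSig K n).language) (n := 0) c default

/-- The interpretation of a predicate. -/
def binRel (p : Fin K) (x y : A.Dom) : Prop :=
  Structure.RelMap (L := (binSig K n).language) (n := 2) ⟨p, rfl⟩ ![x, y]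

/-- The value of a term. -/
def tmVal (v : V → A.Dom) : Tm (binSig K n) V → A.Dom
  | .var x => v x
  | .const c => constVal A c

theorem realize_toTerm (v : V → A.Dom) (t : Tm (binSig K n) V) :
    t.toTerm.realize v = tmVal A v t := by
  cases t with
  | var x => simp [Tm.toTerm, tmVal]
  | const c =>
    exact (Term.realize_constants (L := (binSig K n).language)).trans
      funMap_eq_coe_constants.symm

theorem realize_binAtom (p : Fin K) (s t : Tm (binSig K n) V) (v : V → A.Dom) :
    (binAtom p s t).toFormula.Realize v ↔ binRel A p (tmVal A v s) (tmVal A v t) := by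
  refine (Formula.realize_rel (L := (binSig K n).language) (k := 2)).trans (iff_of_eq ?_)
  refine congrArg (Structure.RelMap (L := (binSig K n).language) (n := 2) ⟨p, rfl⟩) ?_
  funext i
  match i with
  | 0 => exact realize_toTerm A v s
  | 1 => exact realize_toTerm A v t

variable {A B}

theorem Hom.map_binRel (h : A.Dom →[(binSig K n).language] B.Dom) {p : Fin K} {x y : A.Dom}
    (hxy : binRel A p x y) : binRel B p (h x) (h y) := by
  have := h.map_rel _ _ hxy
  rwa [show ⇑h ∘ ![x, y] = ![h x, h y] from funext fun i => by fin_cases i <;> rfl] at this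

theorem Hom.map_constVal (h : A.Dom →[(binSig K n).language] B.Dom) (c : Fin (n + 3)) :
    h (constVal A c) = constVal B c := by
  refine (h.map_fun (n := 0) _ _).trans ?_
  exact congrArg _ (Subsingleton.elim _ _)

/-- A structure over a binary signature from its constants and relations. -/
def binStruct (A : Type u) [Nonempty A] (c : Fin (n + 3) → A) (R : Fin K → A → A → Prop) :
    Struct.{u} (binSig K n) where
  Dom := A
  inst :=
    { funMap := fun {k} => match k with
        | 0 => fun f _ => c f
        | _ + 1 => fun f _ => nomatch f
      RelMap := fun r x => R r.1 (x (Fin.cast r.2 0)) (x (Fin.cast r.2 1)) }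

variable {D : Type u} [Nonempty D]

theorem binRel_binStruct (c : Fin (n + 3) → D) (R : Fin K → D → D → Prop) (p : Fin K) (x y : D) :
    binRel (binStruct D c R) p x y ↔ R p x y := Iff.rfl

/-- The identity is a homomorphism if the relations grow. -/
def binStructHom (c : Fin (n + 3) → D) {R R' : Fin K → D → D → Prop}
    (h : ∀ p x y, R p x y → R' p x y) :
    (binStruct D c R).Dom →[(binSig K n).language] (binStruct D c R').Dom where
  toFun := fun x => x
  map_fun' := by
    rintro (_ | k) f x
    · rfl
    · exact nomatch f
  map_rel' := by
    rintro k r x hr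
    exact h _ _ _ hr

end Binary

/-! ### The rules that simulate a program -/

/-- The predicates used to simulate a program with states `σ`. Unary predicates are represented by
binary ones with both arguments equal. -/
inductive Sym (σ : Type) : Type
  | head | tail | succ | nonzero | goal | trigger | effect
  | call (q : σ) | ret (q : σ) | arg (q : σ)

instance {σ : Type} [Finite σ] : Finite (Sym σ) :=
  Finite.of_surjective (α := Fin 7 ⊕ (Fin 3 × σ))
    (Sum.elim ![.head, .tail, .succ, .nonzero, .goal, .trigger, .effect]
      fun p => ![Sym.call, Sym.ret, Sym.arg] p.1 p.2) (by
    rintro (_ | _ | _ | _ | _ | _ | _ | q | q | q)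
    exacts [⟨.inl 0, rfl⟩, ⟨.inl 1, rfl⟩, ⟨.inl 2, rfl⟩, ⟨.inl 3, rfl⟩, ⟨.inl 4, rfl⟩,
      ⟨.inl 5, rfl⟩, ⟨.inl 6, rfl⟩, ⟨.inr (0, q), rfl⟩, ⟨.inr (1, q), rfl⟩, ⟨.inr (2, q), rfl⟩])

variable {σ : Type} [Finite σ] {n : ℕ} {V : Type}

/-- The signature over which a program with input `n` is simulated. -/
noncomputable abbrev progSig (σ : Type) [Finite σ] (n : ℕ) : Signature := binSig (Nat.card (Sym σ)) n

/-- The number of a predicate. -/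
noncomputable def Sym.num (s : Sym σ) : Fin (Nat.card (Sym σ)) := Finite.equivFin _ s

/-- The atom `s(t, t')`. -/
noncomputable def Sym.atom (s : Sym σ) (t t' : Tm (progSig σ n) V) : Atom (progSig σ n) V :=
  binAtom s.num t t'

/-- The relation that interprets a predicate. -/
def Holds (A : Struct.{u} (progSig σ n)) (s : Sym σ) (x y : A.Dom) : Prop := binRel A s.num x y

theorem realize_atom (A : Struct.{u} (progSig σ n)) (s : Sym σ) (t t' : Tm (progSig σ n) V)
    (v : V → A.Dom) : (s.atom t t').toFormula.Realize v ↔ Holds A s (tmVal A v t) (tmVal A v t') :=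
  realize_binAtom A _ _ _ _

/-- The constant for the empty list. -/
def nilConst (n : ℕ) : Fin (n + 3) := ⟨0, by omega⟩

/-- The constant for the input. -/
def inputConst (n : ℕ) : Fin (n + 3) := ⟨1, by omega⟩

/-- The constant for a number up to the input. -/
def numConst (n k : ℕ) (h : k ≤ n) : Fin (n + 3) := ⟨2 + k, by omega⟩

/-- A universally quantified variable in a body. -/
abbrev bv (i : Fin 4) : Tm (progSig σ n) (Fin 4) := .var i

/-- A universally quantified variable in a head. -/
abbrev hv (i : Fin 4) : Tm (progSig σ n) (Fin 4 ⊕ Fin 1) := .var (.inl i)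

/-- The existentially quantified variable. -/
abbrev ev : Tm (progSig σ n) (Fin 4 ⊕ Fin 1) := .var (.inr 0)

/-- A term for the empty list. -/
abbrev nilTm : Tm (progSig σ n) V := .const (nilConst n)

/-- A term for the number zero. -/
abbrev zeroTm : Tm (progSig σ n) V := .const (numConst n 0 n.zero_le)

/-- A TGD with four universally and one existentially quantified variable, not all of which need
occur, and with head `a ∧ ⋀ l`. -/
abbrev mkRule (body : List (Atom (progSig σ n) (Fin 4))) (a : Atom (progSig σ n) (Fin 4 ⊕ Fin 1))
    (l : List (Atom (progSig σ n) (Fin 4 ⊕ Fin 1))) : TGD (progSig σ n) :=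
  ⟨4, 1, body, a :: l, List.cons_ne_nil _ _⟩

theorem realize_mkRule (A : Struct.{u} (progSig σ n)) (body : List (Atom (progSig σ n) (Fin 4)))
    (a : Atom (progSig σ n) (Fin 4 ⊕ Fin 1)) (l : List (Atom (progSig σ n) (Fin 4 ⊕ Fin 1))) :
    A.Dom ⊨ (mkRule body a l).toSentence ↔
      ∀ v : Fin 4 → A.Dom, (∀ b ∈ body, b.toFormula.Realize v) →
        ∃ y : A.Dom, a.toFormula.Realize (Sum.elim v fun _ => y) ∧
          ∀ b ∈ l, b.toFormula.Realize (Sum.elim v fun _ => y) := by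
  rw [TGD.realize_toSentence]
  refine forall_congr' fun v => imp_congr_right fun _ => ?_
  simp only [List.forall_mem_cons]
  constructor
  · rintro ⟨y, hy⟩
    have hy0 : y = fun _ => y 0 := funext fun i => congrArg y (Subsingleton.elim _ _)
    rw [hy0] at hy
    exact ⟨y 0, hy⟩
  · rintro ⟨y, hy⟩
    exact ⟨fun _ => y, hy⟩

/-- The rules for a state with a given instruction. -/
noncomputable def instrRules (n : ℕ) (q : σ) : Instr σ → List (TGD (progSig σ n))
  | .zero =>
    [mkRule [Sym.atom (.call q) (bv 0) (bv 0)]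
      (Sym.atom (.ret q) (hv 0) ev) [Sym.atom .head ev zeroTm, Sym.atom .tail ev (hv 0)] ]
  | .succ =>
    [mkRule [Sym.atom (.call q) (bv 0) (bv 0), Sym.atom .head (bv 0) (bv 1)]
      (Sym.atom .succ (hv 1) ev) [Sym.atom .nonzero ev ev],
     mkRule [Sym.atom (.call q) (bv 0) (bv 0), Sym.atom .head (bv 0) (bv 1),
        Sym.atom .succ (bv 1) (bv 2)]
      (Sym.atom (.ret q) (hv 0) ev) [Sym.atom .head ev (hv 2), Sym.atom .tail ev nilTm] ]
  | .tail =>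
    [mkRule [Sym.atom (.call q) (bv 0) (bv 0), Sym.atom .tail (bv 0) (bv 1)]
      (Sym.atom (.ret q) (hv 0) (hv 1)) [] ]
  | .cons f g =>
    [mkRule [Sym.atom (.call q) (bv 0) (bv 0)]
      (Sym.atom (.call f) (hv 0) (hv 0)) [Sym.atom (.call g) (hv 0) (hv 0)],
     mkRule [Sym.atom (.call q) (bv 0) (bv 0), Sym.atom (.ret f) (bv 0) (bv 1),
        Sym.atom .head (bv 1) (bv 2), Sym.atom (.ret g) (bv 0) (bv 3)]
      (Sym.atom (.ret q) (hv 0) ev) [Sym.atom .head ev (hv 2), Sym.atom .tail ev (hv 3)] ]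
  | .comp f g =>
    [mkRule [Sym.atom (.call q) (bv 0) (bv 0)] (Sym.atom (.call g) (hv 0) (hv 0)) [],
     mkRule [Sym.atom (.call q) (bv 0) (bv 0), Sym.atom (.ret g) (bv 0) (bv 1)]
      (Sym.atom (.call f) (hv 1) (hv 1)) [],
     mkRule [Sym.atom (.call q) (bv 0) (bv 0), Sym.atom (.ret g) (bv 0) (bv 1),
        Sym.atom (.ret f) (bv 1) (bv 2)]
      (Sym.atom (.ret q) (hv 0) (hv 2)) [] ]
  | .case f g =>
    [mkRule [Sym.atom (.call q) (bv 0) (bv 0), Sym.atom .head (bv 0) zeroTm,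
        Sym.atom .tail (bv 0) (bv 1)]
      (Sym.atom (.call f) (hv 1) (hv 1)) [],
     mkRule [Sym.atom (.call q) (bv 0) (bv 0), Sym.atom .head (bv 0) zeroTm,
        Sym.atom .tail (bv 0) (bv 1), Sym.atom (.ret f) (bv 1) (bv 2)]
      (Sym.atom (.ret q) (hv 0) (hv 2)) [],
     mkRule [Sym.atom (.call q) (bv 0) (bv 0), Sym.atom .head (bv 0) (bv 1),
        Sym.atom .succ (bv 2) (bv 1), Sym.atom .tail (bv 0) (bv 3)]
      (Sym.atom (.arg q) (hv 0) ev) [Sym.atom .head ev (hv 2), Sym.atom .tail ev (hv 3),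
        Sym.atom (.call g) ev ev],
     mkRule [Sym.atom (.arg q) (bv 0) (bv 1), Sym.atom (.ret g) (bv 1) (bv 2)]
      (Sym.atom (.ret q) (hv 0) (hv 2)) [] ]
  | .fix f =>
    [mkRule [Sym.atom (.call q) (bv 0) (bv 0)] (Sym.atom (.call f) (hv 0) (hv 0)) [],
     mkRule [Sym.atom (.call q) (bv 0) (bv 0), Sym.atom (.ret f) (bv 0) (bv 1),
        Sym.atom .head (bv 1) zeroTm, Sym.atom .tail (bv 1) (bv 2)]
      (Sym.atom (.ret q) (hv 0) (hv 2)) [],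
     mkRule [Sym.atom (.call q) (bv 0) (bv 0), Sym.atom (.ret f) (bv 0) (bv 1),
        Sym.atom .head (bv 1) (bv 2), Sym.atom .nonzero (bv 2) (bv 2),
        Sym.atom .tail (bv 1) (bv 3)]
      (Sym.atom (.arg q) (hv 0) (hv 3)) [Sym.atom (.call q) (hv 3) (hv 3)],
     mkRule [Sym.atom (.arg q) (bv 0) (bv 1), Sym.atom (.ret q) (bv 1) (bv 2)]
      (Sym.atom (.ret q) (hv 0) (hv 2)) [] ]

/-- The rules that describe the empty list, turn an output `0` of `q₀` into the goal, and enforce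
a property that is irrelevant to the simulation. -/
noncomputable def baseRules (n : ℕ) (q₀ : σ) : List (TGD (progSig σ n)) :=
  [mkRule [] (Sym.atom .head nilTm zeroTm) [Sym.atom .tail nilTm nilTm],
   mkRule [Sym.atom (.ret q₀) (.const (inputConst n)) (bv 0), Sym.atom .head (bv 0) zeroTm]
    (Sym.atom .goal nilTm nilTm) [],
   mkRule [Sym.atom .trigger (bv 0) (bv 0)] (Sym.atom .effect (hv 0) (hv 0)) [] ]

/-- The rule that describes the input `[n]` and calls `q₀` on it. -/
noncomputable def inputRule (n : ℕ) (q₀ : σ) : TGD (progSig σ n) :=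
  mkRule [] (Sym.atom .head (.const (inputConst n)) (.const (numConst n n le_rfl)))
    [Sym.atom .tail (.const (inputConst n)) nilTm,
     Sym.atom (.call q₀) (.const (inputConst n)) (.const (inputConst n))]

/-- The rule that describes the number `i + 1`. -/
noncomputable def numRule (σ : Type) [Finite σ] (n : ℕ) (i : Fin n) : TGD (progSig σ n) :=
  mkRule [] (Sym.atom .succ (.const (numConst n i i.2.le)) (.const (numConst n (i + 1) i.2)))
    [Sym.atom .nonzero (.const (numConst n (i + 1) i.2)) (.const (numConst n (i + 1) i.2))]

/-- A list of all elements of a finite type. -/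
noncomputable def allStates (σ : Type) [Finite σ] : List σ :=
  (@Finset.univ σ (Fintype.ofFinite σ)).toList

theorem mem_allStates (q : σ) : q ∈ allStates σ := by simp [allStates]

/-- The rules that simulate `P`, started in `q₀` with input `[n]`. -/
noncomputable def progRules (P : σ → Instr σ) (q₀ : σ) (n : ℕ) : List (TGD (progSig σ n)) :=
  (allStates σ).flatMap (fun q => instrRules n q (P q)) ++ baseRules n q₀ ++
    inputRule n q₀ :: (List.finRange n).map (numRule σ n)

/-! ### Every model of the rules contains the simulated evaluation -/

section Soundness

variable (A : Struct.{u} (progSig σ n))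

/-- The element `x` represents a number. -/
def IsNum : ℕ → A.Dom → Prop
  | 0, x => x = constVal A (numConst n 0 n.zero_le)
  | k + 1, x => Holds A .nonzero x x ∧ ∃ y, IsNum k y ∧ Holds A .succ y x

/-- The element `x` represents a list. -/
def IsList : List ℕ → A.Dom → Prop
  | [], x => x = constVal A (nilConst n)
  | a :: l, x => (∃ y, Holds A .head x y ∧ IsNum A a y) ∧ ∃ y, Holds A .tail x y ∧ IsList l y

variable {A} {P : σ → Instr σ} {q₀ : σ}

theorem IsList.head_tail (hA : ∀ r ∈ progRules P q₀ n, A.Dom ⊨ r.toSentence) {l : List ℕ}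
    {x : A.Dom} (h : IsList A l x) : (∃ y, Holds A .head x y ∧ IsNum A l.headI y) ∧
      ∃ y, Holds A .tail x y ∧ IsList A l.tail y := by
  cases l with
  | cons a l => exact h
  | nil =>
    obtain rfl := h
    have h1 := (realize_mkRule A _ _ _).1 (hA (mkRule [] (Sym.atom .head nilTm zeroTm)
      [Sym.atom .tail nilTm nilTm]) (by simp [progRules, baseRules]))
      fun _ => constVal A (nilConst n)
    simp [realize_atom, tmVal] at h1
    exact ⟨⟨_, h1.1, rfl⟩, _, h1.2, rfl⟩

theorem isNum_numConst (hA : ∀ r ∈ progRules P q₀ n, A.Dom ⊨ r.toSentence) (k : ℕ) (hk : k ≤ n) :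
    IsNum A k (constVal A (numConst n k hk)) := by
  induction k with
  | zero => rfl
  | succ k ih =>
    have h1 := (realize_mkRule A _ _ _).1 (hA (numRule σ n ⟨k, hk⟩) (by simp [progRules]))
      fun _ => constVal A (nilConst n)
    simp [realize_atom, tmVal] at h1
    exact ⟨h1.2, _, ih (by omega), h1.1⟩

theorem instrRules_realize (hA : ∀ r ∈ progRules P q₀ n, A.Dom ⊨ r.toSentence) {q : σ}
    {I : Instr σ} (hq : P q = I) : ∀ r ∈ instrRules n q I, A.Dom ⊨ r.toSentence := by
  subst hq
  intro r hr
  exact hA r (by simp only [progRules, List.mem_append, List.mem_flatMap];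
                 exact .inl (.inl ⟨q, mem_allStates q, hr⟩))

theorem Evaluates.exists_ret (hA : ∀ r ∈ progRules P q₀ n, A.Dom ⊨ r.toSentence) {q : σ}
    {v w : List ℕ} (h : Evaluates P q v w) {x : A.Dom} (hx : IsList A v x)
    (hc : Holds A (.call q) x x) : ∃ y, Holds A (.ret q) x y ∧ IsList A w y := by
  induction h generalizing x with
  | zero hq =>
    have hr := instrRules_realize hA hq
    simp only [instrRules, List.forall_mem_cons, realize_mkRule] at hr
    obtain ⟨y, h1, h2⟩ := hr.1 (fun _ => x) (by simpa [realize_atom, tmVal])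
    simp [realize_atom, tmVal] at h1 h2
    exact ⟨y, h1, ⟨_, h2.1, rfl⟩, _, h2.2, hx⟩
  | succ hq =>
    have hr := instrRules_realize hA hq
    simp only [instrRules, List.forall_mem_cons, realize_mkRule] at hr
    obtain ⟨⟨a, ha, ha'⟩, -⟩ := hx.head_tail hA
    obtain ⟨b, h1, h2⟩ := hr.1 ![x, a, a, a] (by simp [realize_atom, tmVal, *])
    simp [realize_atom, tmVal] at h1 h2
    obtain ⟨y, h3, h4⟩ := hr.2.1 ![x, a, b, a] (by simp [realize_atom, tmVal, *])
    simp [realize_atom, tmVal] at h3 h4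
    exact ⟨y, h3, ⟨_, h4.1, h2, _, ha', h1⟩, _, h4.2, rfl⟩
  | tail hq =>
    have hr := instrRules_realize hA hq
    simp only [instrRules, List.forall_mem_cons, realize_mkRule] at hr
    obtain ⟨-, a, ha, ha'⟩ := hx.head_tail hA
    have h1 := hr.1 ![x, a, a, a] (by simp [realize_atom, tmVal, *])
    simp [realize_atom, tmVal] at h1
    exact ⟨a, h1, ha'⟩
  | cons hq hf hg ihf ihg =>
    have hr := instrRules_realize hA hq
    simp only [instrRules, List.forall_mem_cons, realize_mkRule] at hr
    have h1 := hr.1 (fun _ => x) (by simp [realize_atom, tmVal, *])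
    simp [realize_atom, tmVal] at h1
    obtain ⟨a, ha, ha'⟩ := ihf hx h1.1
    obtain ⟨b, hb, hb'⟩ := ihg hx h1.2
    obtain ⟨⟨c, hc1, hc2⟩, -⟩ := ha'.head_tail hA
    obtain ⟨y, h3, h4⟩ := hr.2.1 ![x, a, c, b] (by simp [realize_atom, tmVal, *])
    simp [realize_atom, tmVal] at h3 h4
    exact ⟨y, h3, ⟨_, h4.1, hc2⟩, _, h4.2, hb'⟩
  | comp hq hg hf ihg ihf =>
    have hr := instrRules_realize hA hq
    simp only [instrRules, List.forall_mem_cons, realize_mkRule] at hr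
    have h1 := hr.1 (fun _ => x) (by simp [realize_atom, tmVal, *])
    simp [realize_atom, tmVal] at h1
    obtain ⟨a, ha, ha'⟩ := ihg hx h1
    have h2 := hr.2.1 ![x, a, a, a] (by simp [realize_atom, tmVal, *])
    simp [realize_atom, tmVal] at h2
    obtain ⟨b, hb, hb'⟩ := ihf ha' h2
    have h3 := hr.2.2.1 ![x, a, b, a] (by simp [realize_atom, tmVal, *])
    simp [realize_atom, tmVal] at h3
    exact ⟨b, h3, hb'⟩
  | case_zero hq hv hf ih =>
    have hr := instrRules_realize hA hq
    simp only [instrRules, List.forall_mem_cons, realize_mkRule] at hr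
    obtain ⟨⟨a, ha, ha'⟩, b, hb, hb'⟩ := hx.head_tail hA
    rw [hv] at ha'
    obtain rfl := ha'
    have h1 := hr.1 ![x, b, b, b] (by simp [realize_atom, tmVal, *])
    simp [realize_atom, tmVal] at h1
    obtain ⟨y, hy, hy'⟩ := ih hb' h1
    have h2 := hr.2.1 ![x, b, y, b] (by simp [realize_atom, tmVal, *])
    simp [realize_atom, tmVal] at h2
    exact ⟨y, h2, hy'⟩
  | case_succ hq hv hg ih =>
    have hr := instrRules_realize hA hq
    simp only [instrRules, List.forall_mem_cons, realize_mkRule] at hr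
    obtain ⟨⟨a, ha, ha'⟩, b, hb, hb'⟩ := hx.head_tail hA
    rw [hv] at ha'
    obtain ⟨-, c, hc1, hc2⟩ := ha'
    obtain ⟨d, h1, h2⟩ := hr.2.2.1 ![x, a, c, b] (by simp [realize_atom, tmVal, *])
    simp [realize_atom, tmVal] at h1 h2
    obtain ⟨y, hy, hy'⟩ := ih (x := d) ⟨⟨_, h2.1, hc1⟩, _, h2.2.1, hb'⟩ h2.2.2
    have h3 := hr.2.2.2.1 ![x, d, y, b] (by simp [realize_atom, tmVal, *])
    simp [realize_atom, tmVal] at h3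
    exact ⟨y, h3, hy'⟩
  | fix_done hq hf ha ih =>
    have hr := instrRules_realize hA hq
    simp only [instrRules, List.forall_mem_cons, realize_mkRule] at hr
    have h1 := hr.1 (fun _ => x) (by simp [realize_atom, tmVal, *])
    simp [realize_atom, tmVal] at h1
    obtain ⟨y, hy, hy'⟩ := ih hx h1
    obtain ⟨⟨b, hb, hb'⟩, c, hc1, hc2⟩ := hy'.head_tail hA
    rw [ha] at hb'
    obtain rfl := hb'
    have h2 := hr.2.1 ![x, y, c, x] (by simp [realize_atom, tmVal, *])
    simp [realize_atom, tmVal] at h2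
    exact ⟨c, h2, hc2⟩
  | fix_step hq hf ha _ ihf ihr =>
    have hr := instrRules_realize hA hq
    simp only [instrRules, List.forall_mem_cons, realize_mkRule] at hr
    have h1 := hr.1 (fun _ => x) (by simp [realize_atom, tmVal, *])
    simp [realize_atom, tmVal] at h1
    obtain ⟨y, hy, hy'⟩ := ihf hx h1
    obtain ⟨⟨b, hb, hb'⟩, c, hc1, hc2⟩ := hy'.head_tail hA
    obtain ⟨k, hk⟩ := Nat.exists_eq_succ_of_ne_zero ha
    rw [hk] at hb'
    have hb0 := hb'.1
    have h2 := hr.2.2.1 ![x, y, b, c] (by simp [realize_atom, tmVal, *])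
    simp [realize_atom, tmVal] at h2
    obtain ⟨z, hz, hz'⟩ := ihr hc2 h2.2
    have h3 := hr.2.2.2.1 ![x, c, z, c] (by simp [realize_atom, tmVal, *])
    simp [realize_atom, tmVal] at h3
    exact ⟨z, h3, hz'⟩

theorem holds_goal (hA : ∀ r ∈ progRules P q₀ n, A.Dom ⊨ r.toSentence)
    (h : Evaluates P q₀ [n] [0]) :
    Holds A .goal (constVal A (nilConst n)) (constVal A (nilConst n)) := by
  have h1 := (realize_mkRule A _ _ _).1 (hA (inputRule n q₀) (by simp [progRules]))
    fun _ => constVal A (nilConst n)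
  simp [realize_atom, tmVal] at h1
  obtain ⟨y, hy, ⟨z, hz, rfl⟩, -⟩ := h.exists_ret hA (x := constVal A (inputConst n))
    ⟨⟨_, h1.1, isNum_numConst hA _ _⟩, _, h1.2.1, rfl⟩ h1.2.2
  have h2 := (realize_mkRule A _ _ _).1 (hA (mkRule
    [Sym.atom (.ret q₀) (.const (inputConst n)) (bv 0), Sym.atom .head (bv 0) zeroTm]
    (Sym.atom .goal nilTm nilTm) []) (by simp [progRules, baseRules])) (fun _ => y)
    (by simp [realize_atom, tmVal, *])
  simpa [realize_atom, tmVal] using h2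

end Soundness

/-! ### A finite model without the goal -/

/-- The lists that occur in the finite model for the set `S` of calls. -/
def modelSet (P : σ → Instr σ) (S : Set (σ × List ℕ)) (n : ℕ) : Set (List ℕ) :=
  {[]} ∪ (fun i => [i]) '' Set.Iic n ∪ Prod.snd '' S ∪ ⋃ c ∈ S, {w | Evaluates P c.1 c.2 w}

omit [Finite σ] in
theorem finite_modelSet (P : σ → Instr σ) {S : Set (σ × List ℕ)} (hS : S.Finite) (n : ℕ) :
    (modelSet P S n).Finite :=
  (((Set.finite_singleton _).union ((Set.finite_Iic n).image _)).union (hS.image _)).union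
    (hS.biUnion fun _ _ => Set.Subsingleton.finite fun _ h _ h' => h.unique h')

/-- The interpretation of the predicates in the finite model; a list with head `k` represents the
number `k`, and `t` says whether the trigger holds. -/
def symRel (P : σ → Instr σ) (S : Set (σ × List ℕ)) (t : Prop) :
    Sym σ → List ℕ → List ℕ → Prop
  | .head, x, y => y.headI = x.headI
  | .tail, x, y => y = x.tail
  | .succ, x, y => y.headI = x.headI + 1
  | .nonzero, x, _ => x.headI ≠ 0
  | .goal, _, _ => False
  | .trigger, _, _ => t
  | .effect, _, _ => False
  | .call q, x, _ => (q, x) ∈ S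
  | .ret q, x, y => (q, x) ∈ S ∧ Evaluates P q x y
  | .arg q, x, y => (q, x) ∈ S ∧
      (∀ f g, P q = .case f g → ∀ w, Evaluates P g y w → Evaluates P q x w) ∧
      ∀ f, P q = .fix f → ∀ w, Evaluates P q y w → Evaluates P q x w

section Model

variable (P : σ → Instr σ) (S : Set (σ × List ℕ)) (t : Prop)

/-- The domain of the finite model. -/
abbrev ModelDom (P : σ → Instr σ) (S : Set (σ × List ℕ)) (n : ℕ) : Type u :=
  ULift.{u} (modelSet P S n)

instance : Nonempty (ModelDom.{u} P S n) := ⟨⟨⟨[], .inl (.inl (.inl rfl))⟩⟩⟩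

/-- The interpretation of the constants in the finite model. -/
def modelConst (c : Fin (n + 3)) : ModelDom.{u} P S n :=
  if c.1 = 0 then ⟨[], .inl (.inl (.inl rfl))⟩
  else if c.1 = 1 then ⟨[n], .inl (.inl (.inr ⟨n, Set.mem_Iic.2 le_rfl, rfl⟩))⟩
  else ⟨[c.1 - 2], .inl (.inl (.inr ⟨c.1 - 2, by have := c.2; simp; omega, rfl⟩))⟩

/-- The finite model. -/
noncomputable def finModel (n : ℕ) : Struct.{u} (progSig σ n) :=
  binStruct (ModelDom.{u} P S n) (modelConst P S)
    fun p x y => symRel P S t ((Finite.equivFin (Sym σ)).symm p) x.down.1 y.down.1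

/-- The list that an element of the finite model is. -/
def modelList (x : (finModel.{u} P S t n).Dom) : List ℕ :=
  (show ModelDom.{u} P S n from x).down.1

variable {P S t}

theorem finite_finModel (hS : S.Finite) : Finite (finModel.{u} P S t n).Dom := by
  have := (finite_modelSet P hS n).to_subtype
  exact inferInstanceAs (Finite (ULift (modelSet P S n)))

theorem holds_finModel {s : Sym σ} {x y : (finModel.{u} P S t n).Dom} :
    Holds (finModel.{u} P S t n) s x y ↔ symRel P S t s (modelList P S t x) (modelList P S t y) := by
  have h : (Finite.equivFin (Sym σ)).symm s.num = s := Equiv.symm_apply_apply _ _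
  refine (binRel_binStruct _ _ _ _ _).trans ?_
  rw [h]
  rfl

theorem modelList_nil :
    modelList P S t (constVal (finModel.{u} P S t n) (nilConst n)) = [] := rfl

theorem modelList_input :
    modelList P S t (constVal (finModel.{u} P S t n) (inputConst n)) = [n] := rfl

theorem modelList_num (k : ℕ) (hk : k ≤ n) :
    modelList P S t (constVal (finModel.{u} P S t n) (numConst n k hk)) = [k] := by
  have h0 : (numConst n k hk).1 ≠ 0 := by simp [numConst]
  have h1 : (numConst n k hk).1 ≠ 1 := by simp [numConst]; omega
  have : constVal (finModel.{u} P S t n) (numConst n k hk) =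
    modelConst.{u} P S (numConst n k hk) := rfl
  rw [this, modelConst, if_neg h0, if_neg h1]
  simp [modelList, numConst]

theorem exists_modelList {l : List ℕ} {q : σ} {v : List ℕ} (hc : (q, v) ∈ S)
    (he : Evaluates P q v l) : ∃ x : (finModel.{u} P S t n).Dom, modelList P S t x = l :=
  ⟨(⟨l, .inr (Set.mem_biUnion hc he)⟩ : ModelDom.{u} P S n), rfl⟩

theorem exists_modelList_call {q : σ} {v : List ℕ} (hc : (q, v) ∈ S) :
    ∃ x : (finModel.{u} P S t n).Dom, modelList P S t x = v :=
  ⟨(⟨v, .inl (.inr ⟨_, hc, rfl⟩)⟩ : ModelDom.{u} P S n), rfl⟩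

theorem finModel_instrRules (hS : CallClosed P S) (q : σ) :
    ∀ r ∈ instrRules n q (P q), (finModel.{u} P S t n).Dom ⊨ r.toSentence := by
  rcases hq : P q with _ | _ | _ | ⟨f, g⟩ | ⟨f, g⟩ | ⟨f, g⟩ | f <;>
    simp only [instrRules, List.forall_mem_cons, realize_mkRule, realize_atom, tmVal,
      holds_finModel, symRel, modelList_nil, modelList_num, List.not_mem_nil, false_imp_iff,
      implies_true, and_true, Sum.elim_inl, Sum.elim_inr, List.headI_cons]
  · intro v h
    obtain ⟨y, hy⟩ := exists_modelList h (.zero hq)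
    exact ⟨y, by simp [hy, h, Evaluates.zero hq]⟩
  · refine ⟨fun v h => ?_, fun v h => ?_⟩
    · obtain ⟨y, hy⟩ := exists_modelList h.1 (.succ hq)
      exact ⟨y, by simp [hy, h.2]⟩
    · obtain ⟨y, hy⟩ := exists_modelList h.1 (.succ hq)
      exact ⟨y, by simp [hy, h.1, h.2, Evaluates.succ hq]⟩
  · rintro v ⟨h1, h2⟩
    exact ⟨v 0, h1, h2 ▸ .tail hq⟩
  · refine ⟨fun v h => ⟨v 0, hS.cons_left hq h, hS.cons_right hq h⟩, ?_⟩
    rintro v ⟨h1, h2, h3, h4⟩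
    have := Evaluates.cons hq h2.2 h4.2
    obtain ⟨y, hy⟩ := exists_modelList h1 this
    exact ⟨y, by simp [hy, h1, h3, this]⟩
  · refine ⟨fun v h => ⟨v 0, hS.comp_inner hq h⟩,
      fun v h => ⟨v 0, hS.comp_outer hq h.1 h.2.2⟩,
      fun v h => ⟨v 0, h.1, .comp hq h.2.1.2 h.2.2.2⟩⟩
  · refine ⟨fun v h => ⟨v 0, ?_⟩, fun v h => ⟨v 0, h.1, ?_⟩, fun v h => ?_, fun v h => ⟨v 0, ?_⟩⟩
    · rw [h.2.2]
      exact hS.case_zero hq h.1 h.2.1.symm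
    · exact .case_zero hq h.2.1.symm (h.2.2.1 ▸ h.2.2.2.2)
    · obtain ⟨h1, h2, h3, h4⟩ := h
      have hk := h2.symm.trans h3
      have hc := hS.case_succ hq h1 hk
      obtain ⟨y, hy⟩ := exists_modelList_call hc
      refine ⟨y, ⟨h1, ?_, by simp [hq]⟩, by simp [hy], by simp [hy, h4], hy ▸ hc⟩
      intro f' g' e w hw
      cases hq.symm.trans e
      exact .case_succ hq hk (hy ▸ hw)
    · exact ⟨h.1.1, h.1.2.1 _ _ hq _ h.2.2⟩
  · refine ⟨fun v h => ⟨v 0, hS.fix_body hq h⟩, fun v h => ⟨v 0, h.1, ?_⟩,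
      fun v h => ⟨v 0, ⟨h.1, by simp [hq], ?_⟩, ?_⟩, fun v h => ⟨v 0, ?_⟩⟩
    · rw [h.2.2.2]
      exact .fix_done hq h.2.1.2 h.2.2.1.symm
    · intro f' e w hw
      exact .fix_step hq h.2.1.2 (h.2.2.1 ▸ h.2.2.2.1) (h.2.2.2.2 ▸ hw)
    · rw [h.2.2.2.2]
      exact hS.fix_step hq h.1 h.2.1.2 (h.2.2.1 ▸ h.2.2.2.1)
    · exact ⟨h.1.1, h.1.2.2 _ hq _ h.2.2⟩

theorem finModel_progRules {q₀ : σ} (hS : CallClosed P S) (h₀ : (q₀, [n]) ∈ S)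
    (he : Evaluates P q₀ [n] [1]) :
    ∀ r ∈ progRules P q₀ n, (finModel.{u} P S False n).Dom ⊨ r.toSentence := by
  intro r hr
  simp only [progRules, List.mem_append, List.mem_flatMap, List.mem_cons, List.mem_map] at hr
  rcases hr with (⟨q, -, hr⟩ | hr) | rfl | ⟨i, -, rfl⟩
  · exact finModel_instrRules hS q r hr
  · revert r
    simp only [baseRules, List.forall_mem_cons, realize_mkRule, realize_atom, tmVal,
      holds_finModel, symRel, modelList_nil, modelList_num, modelList_input, List.not_mem_nil,
      false_imp_iff, implies_true, and_true]
    refine ⟨fun _ _ => ⟨constVal _ (nilConst n), rfl, rfl⟩, ?_⟩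
    rintro v ⟨⟨-, h1⟩, h2⟩
    rw [← he.unique h1] at h2
    cases h2
  · simp only [inputRule, List.forall_mem_cons, realize_mkRule, realize_atom, tmVal,
      holds_finModel, symRel, modelList_nil, modelList_num, modelList_input, List.not_mem_nil,
      false_imp_iff, implies_true, and_true]
    exact fun _ _ => ⟨constVal _ (nilConst n), trivial, rfl, h₀⟩
  · simp only [numRule, List.forall_mem_cons, realize_mkRule, realize_atom, tmVal,
      holds_finModel, symRel, modelList_num, List.not_mem_nil,
      false_imp_iff, implies_true, and_true]
    exact fun _ _ => ⟨constVal _ (nilConst n), rfl, by simp⟩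

end Model

/-! ### Homclosedness and the output of the program -/

theorem homClosed_of_goal {P : σ → Instr σ} {q₀ : σ} {Φ : (progSig σ n).language.Sentence}
    (hΦ : ∀ A : Struct.{u} (progSig σ n), A.Dom ⊨ Φ ↔
      (∀ r ∈ progRules P q₀ n, A.Dom ⊨ r.toSentence) ∨
        Holds A .goal (constVal A (nilConst n)) (constVal A (nilConst n)))
    (h : Evaluates P q₀ [n] [0]) : HomClosed.{u} Φ ∧ HomClosedFin.{u} Φ := by
  have hgoal : ∀ A : Struct.{u} (progSig σ n), A.Dom ⊨ Φ ↔
      Holds A .goal (constVal A (nilConst n)) (constVal A (nilConst n)) := fun A =>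
    (hΦ A).trans ⟨fun hA => hA.elim (holds_goal · h) id, .inr⟩
  have hmap : ∀ A B : Struct.{u} (progSig σ n), A.Dom ⊨ Φ →
      Nonempty (A.Dom →[(progSig σ n).language] B.Dom) → B.Dom ⊨ Φ := by
    rintro A B hA ⟨f⟩
    have := Hom.map_binRel f ((hgoal A).1 hA)
    rw [Hom.map_constVal] at this
    exact (hgoal B).2 this
  constructor
  · ext B
    exact ⟨fun hB => ⟨B, hB, ⟨.id _ _⟩⟩, fun ⟨A, hA, hf⟩ => hmap A B hA hf⟩
  · ext B
    exact ⟨fun hB => ⟨⟨B, hB, ⟨.id _ _⟩⟩, hB.2⟩, fun ⟨⟨A, hA, hf⟩, hB⟩ => ⟨hmap A B hA.1 hf, hB⟩⟩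

theorem not_homClosed_of_no_goal {P : σ → Instr σ} {q₀ : σ}
    {Φ : (progSig σ n).language.Sentence}
    (hΦ : ∀ A : Struct.{u} (progSig σ n), A.Dom ⊨ Φ ↔
      (∀ r ∈ progRules P q₀ n, A.Dom ⊨ r.toSentence) ∨
        Holds A .goal (constVal A (nilConst n)) (constVal A (nilConst n)))
    (h : Evaluates P q₀ [n] [1]) : ¬ HomClosed.{u} Φ ∧ ¬ HomClosedFin.{u} Φ := by
  obtain ⟨S, hfin, hS, h₀⟩ := h.exists_callClosed
  let A : Struct.{u} (progSig σ n) := finModel P S False n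
  let B : Struct.{u} (progSig σ n) := finModel P S True n
  have hA : A.Dom ⊨ Φ := (hΦ A).2 (.inl (finModel_progRules hS h₀ h))
  have hB : ¬ B.Dom ⊨ Φ := by
    rw [hΦ B]
    rintro (hr | hg)
    · obtain ⟨y, hy, -⟩ := (realize_mkRule B _ _ _).1 (hr (mkRule
        [Sym.atom .trigger (bv 0) (bv 0)] (Sym.atom .effect (hv 0) (hv 0)) [])
        (by simp [progRules, baseRules])) (fun _ => constVal B (nilConst n))
        (by simp [realize_atom, B, holds_finModel, symRel])
      exact holds_finModel.1 ((realize_atom B _ _ _ _).1 hy)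
    · exact holds_finModel.1 hg
  have f : A.Dom →[(progSig σ n).language] B.Dom := by
    refine binStructHom _ fun p x y => ?_
    cases (Finite.equivFin (Sym σ)).symm p <;> simp [symRel]
  constructor
  · intro hc
    exact hB (hc.ge (show B ∈ homClosure _ from ⟨A, hA, ⟨f⟩⟩))
  · intro hc
    exact hB (hc.ge (show B ∈ homClosureFin _ from
      ⟨⟨A, ⟨hA, finite_finModel hfin⟩, ⟨f⟩⟩, finite_finModel hfin⟩)).1

/-! ### The sentences -/

/-- The mildly disjunctive sentence that simulates `P` on input `[n]`. -/
noncomputable def progMDTGD (P : σ → Instr σ) (q₀ : σ) (n : ℕ) : MDTGD (progSig σ n) where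
  rules := progRules P q₀ n
  query := .ex 0 [.rel (Sym.atom .goal nilTm nilTm)]

/-- A rule with the goal as a second disjunct. -/
noncomputable def orGoal (r : TGD (progSig σ n)) : DisjTGD (progSig σ n) where
  numAll := r.numAll
  numEx := r.numEx
  body := r.body
  head := [r.head, [Sym.atom .goal nilTm nilTm] ]
  head_ne := List.cons_ne_nil _ _
  head_conj_ne := by simpa using r.head_ne

/-- The disjunctive sentence that simulates `P` on input `[n]`. -/
noncomputable def progDTGD (P : σ → Instr σ) (q₀ : σ) (n : ℕ) : DTGD (progSig σ n) where
  rules := (progRules P q₀ n).map orGoal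

theorem progRules_numAll_numEx (P : σ → Instr σ) (q₀ : σ) (n : ℕ) :
    ∀ r ∈ progRules P q₀ n, r.numAll = 4 ∧ r.numEx = 1 := by
  intro r hr
  simp only [progRules, List.mem_append, List.mem_flatMap, List.mem_cons, List.mem_map] at hr
  rcases hr with (⟨q, -, hr⟩ | hr) | rfl | ⟨i, -, rfl⟩
  · revert r
    cases P q <;> simp [instrRules]
  · revert r
    simp [baseRules]
  · exact ⟨rfl, rfl⟩
  · exact ⟨rfl, rfl⟩

theorem progMDTGD_small (P : σ → Instr σ) (q₀ : σ) (n : ℕ) : (progMDTGD P q₀ n).Small 4 1 2 := by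
  refine ⟨fun _ => le_rfl, fun r hr => ?_, Nat.zero_le _, by simp⟩
  obtain ⟨h1, h2⟩ := progRules_numAll_numEx P q₀ n r hr
  exact ⟨h1.le, h2.le⟩

theorem progDTGD_small (P : σ → Instr σ) (q₀ : σ) (n : ℕ) : (progDTGD P q₀ n).Small 4 1 2 := by
  refine ⟨fun _ => le_rfl, fun r' hr' => ?_⟩
  obtain ⟨r, hr, rfl⟩ := List.mem_map.1 hr'
  obtain ⟨h1, h2⟩ := progRules_numAll_numEx P q₀ n r hr
  exact ⟨h1.le, h2.le⟩

theorem realize_progMDTGD (P : σ → Instr σ) (q₀ : σ) (n : ℕ) (A : Struct.{u} (progSig σ n)) :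
    A.Dom ⊨ (progMDTGD P q₀ n).toSentence ↔
      (∀ r ∈ progRules P q₀ n, A.Dom ⊨ r.toSentence) ∨
        Holds A .goal (constVal A (nilConst n)) (constVal A (nilConst n)) := by
  rw [MDTGD.realize_toSentence]
  refine or_congr Iff.rfl ?_
  simp [progMDTGD, CQ.toSentence, realize_exClosure, realize_conj, EqAtom.toFormula, realize_atom,
    tmVal]

theorem realize_orGoal (A : Struct.{u} (progSig σ n)) (r : TGD (progSig σ n)) :
    A.Dom ⊨ (orGoal r).toSentence ↔ A.Dom ⊨ r.toSentence ∨
        Holds A .goal (constVal A (nilConst n)) (constVal A (nilConst n)) := by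
  rw [DisjTGD.realize_toSentence, TGD.realize_toSentence]
  change (∀ v : Fin r.numAll → A.Dom, (∀ a ∈ r.body, a.toFormula.Realize v) →
    ∃ y : Fin r.numEx → A.Dom, ∃ ψ ∈ [r.head, [Sym.atom .goal nilTm nilTm] ],
      ∀ a ∈ ψ, a.toFormula.Realize (Sum.elim v y)) ↔ _
  by_cases hg : Holds A .goal (constVal A (nilConst n)) (constVal A (nilConst n)) <;>
    simp [realize_atom, tmVal, hg]

theorem realize_progDTGD (P : σ → Instr σ) (q₀ : σ) (n : ℕ) (A : Struct.{u} (progSig σ n)) :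
    A.Dom ⊨ (progDTGD P q₀ n).toSentence ↔
      (∀ r ∈ progRules P q₀ n, A.Dom ⊨ r.toSentence) ∨
        Holds A .goal (constVal A (nilConst n)) (constVal A (nilConst n)) := by
  simp only [DTGD.realize_toSentence, progDTGD, List.forall_mem_map, realize_orGoal]
  by_cases hg : Holds A .goal (constVal A (nilConst n)) (constVal A (nilConst n)) <;> simp [hg]

/-! ### The reductions are computable -/

theorem instrRules_code (n : ℕ) (q : σ) (I : Instr σ) :
    (instrRules n q I).map TGD.code = (instrRules 0 q I).map TGD.code := by
  cases I <;> rfl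

theorem baseRules_code (n : ℕ) (q : σ) :
    (baseRules n q).map TGD.code = (baseRules 0 q).map TGD.code := rfl

theorem primrec_atomCode {f g : ℕ → ℕ} (p : ℕ) (hf : Primrec f) (hg : Primrec g) :
    Primrec fun n => ((p, [.inr (f n), .inr (g n)]) : AtomCode) :=
  (Primrec.const p).pair (Primrec.list_cons.comp (Primrec.sumInr.comp hf)
    (Primrec.list_cons.comp (Primrec.sumInr.comp hg) (Primrec.const [])))

theorem primrec_inputRule_code (q₀ : σ) : Primrec fun n => (inputRule n q₀).code := by
  have h : Primrec fun n : ℕ => 2 + n := Primrec.nat_add.comp (.const 2) .id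
  exact (Primrec.const 4).pair ((Primrec.const 1).pair ((Primrec.const []).pair
    (Primrec.list_cons.comp (primrec_atomCode (Sym.head : Sym σ).num.1 (.const 1) h)
    (Primrec.const ([((Sym.tail : Sym σ).num.1, [.inr 1, .inr 0]),
      ((Sym.call q₀).num.1, [.inr 1, .inr 1])] : List AtomCode)))))

/-- The code of the rule that describes the number `i + 1`. -/
noncomputable def numRuleCode (σ : Type) [Finite σ] (i : ℕ) : TGDCode :=
  (4, 1, [], [((Sym.succ : Sym σ).num.1, [.inr (2 + i), .inr (2 + (i + 1))]),
    ((Sym.nonzero : Sym σ).num.1, [.inr (2 + (i + 1)), .inr (2 + (i + 1))])])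

theorem primrec_numRuleCode (σ : Type) [Finite σ] : Primrec (numRuleCode σ) := by
  have h : Primrec fun n : ℕ => 2 + n := Primrec.nat_add.comp (.const 2) .id
  have h' : Primrec fun n : ℕ => 2 + (n + 1) := Primrec.nat_add.comp (.const 2) Primrec.succ
  exact (Primrec.const 4).pair ((Primrec.const 1).pair ((Primrec.const []).pair
    (Primrec.list_cons.comp (primrec_atomCode _ h h')
    (Primrec.list_cons.comp (primrec_atomCode _ h' h') (Primrec.const [])))))

theorem primrec_progRules_code (P : σ → Instr σ) (q₀ : σ) :
    Primrec fun n => (progRules P q₀ n).map TGD.code := by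
  have h : ∀ n, (progRules P q₀ n).map TGD.code =
      (((allStates σ).flatMap fun q => (instrRules 0 q (P q)).map TGD.code) ++
        (baseRules 0 q₀).map TGD.code) ++
        (inputRule n q₀).code :: (List.range n).map (numRuleCode σ) := by
    intro n
    simp only [progRules, List.map_append, List.map_flatMap, List.map_cons, List.map_map,
      instrRules_code n, baseRules_code n]
    rw [← List.map_coe_finRange_eq_range, List.map_map]
    rfl
  simp only [h]
  exact Primrec.list_append.comp (.const _) (Primrec.list_cons.comp (primrec_inputRule_code q₀)
    (Primrec.list_map Primrec.list_range ((primrec_numRuleCode σ).comp .snd).to₂))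

theorem primrec_sigCode (σ : Type) [Finite σ] : Primrec fun n => (progSig σ n).code :=
  (Primrec.nat_add.comp .id (.const 3)).pair (.const (List.ofFn fun _ : Fin (Nat.card (Sym σ)) => 2))

theorem primrec_progMDTGD_code (P : σ → Instr σ) (q₀ : σ) :
    Primrec fun n => (progMDTGD P q₀ n).code :=
  (primrec_sigCode σ).pair ((primrec_progRules_code P q₀).pair
    (.const (some (0, [.inl ((Sym.goal : Sym σ).num.1, [.inr 0, .inr 0])]) : CQCode)))

theorem primrec_progDTGD_code (P : σ → Instr σ) (q₀ : σ) :
    Primrec fun n => (progDTGD P q₀ n).code := by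
  let goal : List AtomCode := [((Sym.goal : Sym σ).num.1, [.inr 0, .inr 0])]
  let g : TGDCode → DisjTGDCode := fun r => (r.1, r.2.1, r.2.2.1, [r.2.2.2, goal])
  have hg : Primrec g := Primrec.fst.pair ((Primrec.fst.comp .snd).pair
    ((Primrec.fst.comp (Primrec.snd.comp .snd)).pair (Primrec.list_cons.comp
      (Primrec.snd.comp (Primrec.snd.comp .snd)) (Primrec.const [goal]))))
  have h : ∀ n, (progDTGD P q₀ n).code =
      ((progSig σ n).code, ((progRules P q₀ n).map TGD.code).map g) := by
    intro n
    simp only [DTGD.code, progDTGD, List.map_map]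
    rfl
  simp only [h]
  exact (primrec_sigCode σ).pair
    (Primrec.list_map (primrec_progRules_code P q₀) (hg.comp .snd).to₂)

/-! ### Undecidability -/

theorem Undecidable.mono {I C : Type*} [Primcodable C] {code : I → C} {D D' P : I → Prop}
    (h : Undecidable code D P) (hD : ∀ i, D i → D' i) : Undecidable code D' P :=
  fun ⟨f, hf, hP⟩ => h ⟨f, hf, fun i hi => hP i (hD i hi)⟩

/-- A problem is undecidable if it separates the inputs on which some program that is not
computably separable returns `0` from those on which it returns `1`. -/
theorem undecidable_of_program {I C : Type*} [Primcodable C] {code : I → C} {D Q : I → Prop}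
    (e : ∀ (σ : Type) [Finite σ], (σ → Instr σ) → σ → ℕ → I)
    (hcode : ∀ (σ : Type) [Finite σ] (P : σ → Instr σ) (q₀ : σ),
      Primrec fun n => code (e σ P q₀ n))
    (hD : ∀ (σ : Type) [Finite σ] (P : σ → Instr σ) (q₀ : σ) (n : ℕ), D (e σ P q₀ n))
    (hzero : ∀ (σ : Type) [Finite σ] (P : σ → Instr σ) (q₀ : σ) (n : ℕ),
      Evaluates P q₀ [n] [0] → Q (e σ P q₀ n))
    (hone : ∀ (σ : Type) [Finite σ] (P : σ → Instr σ) (q₀ : σ) (n : ℕ),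
      Evaluates P q₀ [n] [1] → ¬ Q (e σ P q₀ n)) : Undecidable code D Q := by
  rintro ⟨f, hf, h⟩
  obtain ⟨σ, _, P, q₀, hP⟩ := exists_inseparable_program
  obtain ⟨n, ⟨hn, he⟩ | ⟨hn, he⟩⟩ := hP _ (hf.comp (hcode σ P q₀).to_comp)
  · exact hone σ P q₀ n he ((h _ (hD σ P q₀ n)).1 hn)
  · have := (h _ (hD σ P q₀ n)).2 (hzero σ P q₀ n he)
    simp_all

theorem undecidableForMDTGD_homClosed_small : UndecidableForMDTGD (fun _ Φ => Φ.Small 4 1 2)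
    (fun _ Φ => HomClosed.{u} Φ) :=
  undecidable_of_program (fun σ _ P q₀ n => ⟨progSig σ n, progMDTGD P q₀ n⟩)
    (fun _ _ P q₀ => primrec_progMDTGD_code P q₀) (fun _ _ P q₀ n => progMDTGD_small P q₀ n)
    (fun _ _ P q₀ n h => (homClosed_of_goal (realize_progMDTGD P q₀ n) h).1)
    (fun _ _ P q₀ n h => (not_homClosed_of_no_goal (realize_progMDTGD P q₀ n) h).1)

theorem undecidableForMDTGD_homClosedFin_small : UndecidableForMDTGD (fun _ Φ => Φ.Small 4 1 2)
    (fun _ Φ => HomClosedFin.{u} Φ) :=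
  undecidable_of_program (fun σ _ P q₀ n => ⟨progSig σ n, progMDTGD P q₀ n⟩)
    (fun _ _ P q₀ => primrec_progMDTGD_code P q₀) (fun _ _ P q₀ n => progMDTGD_small P q₀ n)
    (fun _ _ P q₀ n h => (homClosed_of_goal (realize_progMDTGD P q₀ n) h).2)
    (fun _ _ P q₀ n h => (not_homClosed_of_no_goal (realize_progMDTGD P q₀ n) h).2)

theorem undecidableForDTGD_homClosed_small : UndecidableForDTGD (fun _ Φ => Φ.Small 4 1 2)
    (fun _ Φ => HomClosed.{u} Φ) :=
  undecidable_of_program (fun σ _ P q₀ n => ⟨progSig σ n, progDTGD P q₀ n⟩)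
    (fun _ _ P q₀ => primrec_progDTGD_code P q₀) (fun _ _ P q₀ n => progDTGD_small P q₀ n)
    (fun _ _ P q₀ n h => (homClosed_of_goal (realize_progDTGD P q₀ n) h).1)
    (fun _ _ P q₀ n h => (not_homClosed_of_no_goal (realize_progDTGD P q₀ n) h).1)

theorem undecidableForDTGD_homClosedFin_small : UndecidableForDTGD (fun _ Φ => Φ.Small 4 1 2)
    (fun _ Φ => HomClosedFin.{u} Φ) :=
  undecidable_of_program (fun σ _ P q₀ n => ⟨progSig σ n, progDTGD P q₀ n⟩)
    (fun _ _ P q₀ => primrec_progDTGD_code P q₀) (fun _ _ P q₀ n => progDTGD_small P q₀ n)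
    (fun _ _ P q₀ n h => (homClosed_of_goal (realize_progDTGD P q₀ n) h).2)
    (fun _ _ P q₀ n h => (not_homClosed_of_no_goal (realize_progDTGD P q₀ n) h).2)

end HomClosure

/-- Homclosedness and finite homclosedness are undecidable for MDTGD, for DTGD, and for the
restrictions of both to at most 4 universally quantified variables and at most 1 existentially
quantified variable and to predicates of arity at most 2. -/
theorem mainTheorem8 :
    (HomClosure.UndecidableForMDTGD (fun _ _ => True) (fun _ Φ => HomClosure.HomClosed.{u} Φ) ∧
      HomClosure.UndecidableForMDTGD (fun _ _ => True)
        (fun _ Φ => HomClosure.HomClosedFin.{u} Φ)) ∧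
    (HomClosure.UndecidableForDTGD (fun _ _ => True) (fun _ Φ => HomClosure.HomClosed.{u} Φ) ∧
      HomClosure.UndecidableForDTGD (fun _ _ => True)
        (fun _ Φ => HomClosure.HomClosedFin.{u} Φ)) ∧
    (HomClosure.UndecidableForMDTGD (fun _ Φ => Φ.Small 4 1 2)
        (fun _ Φ => HomClosure.HomClosed.{u} Φ) ∧
      HomClosure.UndecidableForMDTGD (fun _ Φ => Φ.Small 4 1 2)
        (fun _ Φ => HomClosure.HomClosedFin.{u} Φ)) ∧
    (HomClosure.UndecidableForDTGD (fun _ Φ => Φ.Small 4 1 2)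
        (fun _ Φ => HomClosure.HomClosed.{u} Φ) ∧
      HomClosure.UndecidableForDTGD (fun _ Φ => Φ.Small 4 1 2)
        (fun _ Φ => HomClosure.HomClosedFin.{u} Φ)) := by
  exact
    ⟨⟨HomClosure.undecidableForMDTGD_homClosed_small.mono fun _ _ => trivial,
      HomClosure.undecidableForMDTGD_homClosedFin_small.mono fun _ _ => trivial⟩,
    ⟨HomClosure.undecidableForDTGD_homClosed_small.mono fun _ _ => trivial,
      HomClosure.undecidableForDTGD_homClosedFin_small.mono fun _ _ => trivial⟩,
    ⟨HomClosure.undecidableForMDTGD_homClosed_small,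
      HomClosure.undecidableForMDTGD_homClosedFin_small⟩,
    HomClosure.undecidableForDTGD_homClosed_small,
    HomClosure.undecidableForDTGD_homClosedFin_small⟩
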